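/- Fix a first-order signature $\Sigma=CS\cup FS$ ($CS$, $FS$ disjoint sets of constructor and function symbols with arities) and a denumerable set $\mathcal V$ of variables. Let-expressions are $e ::= X \mid h(e_1,\dots,e_n)\mid let\ X=e_1\ in\ e_2$ with $X\in\mathcal V$ and $h\in\Sigma$ of arity $n$ ($X$ is bound in $e_2$ but not in $e_1$); they are taken modulo renaming of bound variables, and substitution avoids capture. $LExp$ is the set of let-expressions, and $CTerm$ (c-terms) its subset of expressions built from variables and constructors only; $LExp_\perp$ and $CTerm_\perp$ are defined in the same way after adding a new constructor $\perp$ of arity $0$. $CSubst$ (resp. $CSubst_\perp$) is the set of substitutions with values in $CTerm$ (resp. $CTerm_\perp$). A program $\mathcal P$ is any set of rules $f(p_1,\dots,p_n)\to r$ with $f\in FS$ of arity $n$, $r\in LExp$, and $(p_1,\dots,p_n)$ a tuple of c-terms in which no variable occurs twice; $r$ may contain variables that do not occur in $p_1,\dots,p_n$. One-hole contexts $\mathcal C$ are formed with function and constructor symbols and with both positions of a let, and $BV(\mathcal C)$ is the set of variables bound at the hole of $\mathcal C$. The relation $\sqsubseteq$ is the least partial order on $LExp_\perp$ with $\perp\sqsubseteq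 e$ that is closed under contexts, and $E{\downarrow}=\{e'\in LExp_\perp\mid \exists e\in E.\ e'\sqsubseteq e\}$. The relation $\mathcal P\vdash_{CRWL_{let}} e\rightarrowtriangle t$ ($e\in LExp_\perp$, $t\in CTerm_\perp$) is defined inductively by the rules: (B) $e\rightarrowtriangle\perp$; (RR) $X\rightarrowtriangle X$ for $X\in\mathcal V$; (DC) $c(e_1,\dots,e_n)\rightarrowtriangle c(t_1,\dots,t_n)$ if $c\in CS$ and $e_i\rightarrowtriangle t_i$ for all $i$; (OR) $f(e_1,\dots,e_n)\rightarrowtriangle t$ if $(f(p_1,\dots,p_n)\to r)\in\mathcal P$, $\theta\in CSubst_\perp$, $e_i\rightarrowtriangle p_i\theta$ for all $i$, and $r\theta\rightarrowtriangle t$; (Let) $let\ X=e_1\ in\ e_2\rightarrowtriangle t$ if $e_1\rightarrowtriangle t_1$ and $e_2[X/t_1]\rightarrowtriangle t$ for some $t_1\in CTerm_\perp$. $\mathcal P\vdash_{CRWL}$ is defined by the same rules without (Let). The denotation of $e\in LExp_\perp$ is $[\![e]\!]=\{t\in CTerm_\perp\mid \mathcal P\vdash_{CRWL_{let}}e\rightarrowtriangle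 t\}$, and its hyperdenotation is the function $[\![\![e]\!]\!]:\theta\in CSubst_\perp\mapsto[\![e\theta]\!]$. The let-rewriting relation $\to^l$ on $LExp$ consists of the steps $\mathcal C[a]\to^l\mathcal C[a']$, for any (possibly empty) context $\mathcal C$, where $a\to a'$ is one of: (Fapp) $f(p_1,\dots,p_n)\theta\to r\theta$ with $(f(p_1,\dots,p_n)\to r)\in\mathcal P$ and $\theta\in CSubst$, where no variable of $BV(\mathcal C)$ occurs in the instance $Z\theta$ of an extra variable $Z$ of the rule; (LetIn) $h(\dots,e,\dots)\to let\ X=e\ in\ h(\dots,X,\dots)$ with $h\in\Sigma$, $X$ fresh, and $e$ rooted by a function symbol or a let; (Bind) $let\ X=t\ in\ e\to e[X/t]$ with $t\in CTerm$; (Elim) $let\ X=e_1\ in\ e_2\to e_2$ with $X\notin FV(e_2)$; (Flat) $let\ X=(let\ Y=e_1\ in\ e_2)\ in\ e_3\to let\ Y=e_1\ in\ (let\ X=e_2\ in\ e_3)$ with $Y\notin FV(e_3)$. Let-rewriting $\to^l_\perp$ on $LExp_\perp$ is defined by the same rules with $\perp$ counted as a constructor, i.e. with $CSubst_\perp$ and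 $CTerm_\perp$ in place of $CSubst$ and $CTerm$. The shell of an expression is given by $|X|=X$, $|\!\perp\!|=\perp$, $|c(e_1,\dots,e_n)|=c(|e_1|,\dots,|e_n|)$ for $c\in CS$, $|f(e_1,\dots,e_n)|=\perp$ for $f\in FS$, and $|let\ X=e_1\ in\ e_2|=|e_2|[X/|e_1|]$. **Theorem.** For every program $\mathcal P$ and every $e\in LExp$: 1. $[\![e]\!]=\{|e'| \mid e\to^{l*}e'\}{\downarrow}$; 2. $[\![\![e]\!]\!]=\lambda\theta\in CSubst_\perp.\ \big(\{|e'| \mid e\theta\to^{l*}_\perp e'\}{\downarrow}\big)$; 3. for every $t\in CTerm$: $\mathcal P\vdash_{CRWL_{let}}e\rightarrowtriangle t$ if and only if $e\to^{l*}t$; 4. if neither $\mathcal P$ nor $e$ contains lets, then for every $t\in CTerm$: $\mathcal P\vdash_{CRWL}e\rightarrowtriangle t$ if and only if $e\to^{l*}t$. -/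

import Mathlib

namespace LetRw

universe u v

/-- A first-order signature: constructor symbols and function symbols (disjoint by typing),
each with an arity. -/
structure Signature where
  CS : Type u
  FS : Type v
  carity : CS → ℕ
  farity : FS → ℕ

/-- Partial let-expressions (`LExp_⊥`), modulo renaming of bound variables.
The denumerable set of variables is `ℕ` and bound variables are represented by de Bruijn indices:
in `letIn e₁ e₂` (that is, `let X = e₁ in e₂`) the bound variable `X` is the index `0` of `e₂`, and
the index `n + 1` of `e₂` is the variable `n` of the surrounding scope. Lets are not recursive:
`X` is not in scope in `e₁`. -/
inductive LExp (S : Signature.{u, v}) : Type (max u v) where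
  | var (n : ℕ) : LExp S
  | bot : LExp S
  | con (c : S.CS) (args : Fin (S.carity c) → LExp S) : LExp S
  | fn (f : S.FS) (args : Fin (S.farity f) → LExp S) : LExp S
  | letIn (e₁ e₂ : LExp S) : LExp S

namespace LExp

variable {S : Signature.{u, v}}

/-- `e ∈ LExp`: the symbol `⊥` does not occur in `e`. -/
def Total : LExp S → Prop
  | var _ => True
  | bot => False
  | con _ args => ∀ i, (args i).Total
  | fn _ args => ∀ i, (args i).Total
  | letIn e₁ e₂ => e₁.Total ∧ e₂.Total

/-- `e ∈ Exp_⊥`: no let occurs in `e`. -/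
def LetFree : LExp S → Prop
  | var _ => True
  | bot => True
  | con _ args => ∀ i, (args i).LetFree
  | fn _ args => ∀ i, (args i).LetFree
  | letIn _ _ => False

/-- `t ∈ CTerm_⊥`: a partial c-term (no function symbols, no lets). -/
def IsPCTerm : LExp S → Prop
  | var _ => True
  | bot => True
  | con _ args => ∀ i, (args i).IsPCTerm
  | fn _ _ => False
  | letIn _ _ => False

/-- `t ∈ CTerm`: a (total) c-term. -/
def IsCTerm (t : LExp S) : Prop := t.IsPCTerm ∧ t.Total

/-- Number of free occurrences of the variable `x` in an expression. -/
def occ : LExp S → ℕ → ℕ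
  | var n, x => if n = x then 1 else 0
  | bot, _ => 0
  | con _ args, x => ∑ i, (args i).occ x
  | fn _ args, x => ∑ i, (args i).occ x
  | letIn e₁ e₂, x => e₁.occ x + e₂.occ (x + 1)

/-- The set of free variables. -/
def FV (e : LExp S) : Set ℕ := {x | 0 < e.occ x}

/-- Lifting of a renaming of variables under a binder. -/
def liftRen (ρ : ℕ → ℕ) : ℕ → ℕ
  | 0 => 0
  | n + 1 => ρ n + 1

/-- Capture-avoiding renaming of the free variables. -/
def ren : (ℕ → ℕ) → LExp S → LExp S
  | ρ, var n => var (ρ n)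
  | _, bot => bot
  | ρ, con c args => con c fun i => ren ρ (args i)
  | ρ, fn f args => fn f fun i => ren ρ (args i)
  | ρ, letIn e₁ e₂ => letIn (ren ρ e₁) (ren (liftRen ρ) e₂)

/-- The expression `e` seen from inside one more binder (whose variable is fresh for `e`). -/
def shift (e : LExp S) : LExp S := ren Nat.succ e

/-- Lifting of a substitution under a binder. -/
def up (σ : ℕ → LExp S) : ℕ → LExp S
  | 0 => var 0
  | n + 1 => (σ n).shift

/-- Capture-avoiding (simultaneous) substitution `eσ`. -/
def subst : (ℕ → LExp S) → LExp S → LExp S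
  | σ, var n => σ n
  | _, bot => bot
  | σ, con c args => con c fun i => subst σ (args i)
  | σ, fn f args => fn f fun i => subst σ (args i)
  | σ, letIn e₁ e₂ => letIn (subst σ e₁) (subst (up σ) e₂)

/-- The substitution `[X/e]`, where `X` is the variable of an outermost binder being removed. -/
def single (e : LExp S) : ℕ → LExp S
  | 0 => e
  | n + 1 => var n

/-- `e₂[X/e₁]` for the body `e₂` of `let X = … in e₂`. -/
def inst (e₂ e₁ : LExp S) : LExp S := subst (single e₁) e₂

/-- The shell `|e|` (with `⊥` a constructor symbol of arity `0`). -/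
def shell : LExp S → LExp S
  | var n => var n
  | bot => bot
  | con c args => con c fun i => (args i).shell
  | fn _ _ => bot
  | letIn e₁ e₂ => e₂.shell.inst e₁.shell

/-- `e` is rooted by a function symbol or is a let. -/
def Suspendable : LExp S → Prop
  | fn _ _ => True
  | letIn _ _ => True
  | _ => False

end LExp

open LExp

variable {S : Signature.{u, v}}

/-- One-hole contexts. In `con c i args C` and `fn f i args C` the context `C` stands at the
argument position `i`, and the entry `args i` is ignored. -/
inductive Ctx (S : Signature.{u, v}) : Type (max u v) where
  | hole : Ctx S
  | con (c : S.CS) (i : Fin (S.carity c)) (args : Fin (S.carity c) → LExp S) (C : Ctx S) : Ctx S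
  | fn (f : S.FS) (i : Fin (S.farity f)) (args : Fin (S.farity f) → LExp S) (C : Ctx S) : Ctx S
  | letL (C : Ctx S) (e : LExp S) : Ctx S
  | letR (e : LExp S) (C : Ctx S) : Ctx S

/-- `C[e]`. The indices `< C.depth` of `e` get bound by the lets of `C` above the hole. -/
def Ctx.fill : Ctx S → LExp S → LExp S
  | .hole, e => e
  | .con c i args C, e => LExp.con c (Function.update args i (C.fill e))
  | .fn f i args C, e => LExp.fn f (Function.update args i (C.fill e))
  | .letL C e₂, e => LExp.letIn (C.fill e) e₂
  | .letR e₁ C, e => LExp.letIn e₁ (C.fill e)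

/-- The number of let-bound variables visible from the hole; seen from the hole, the set `BV(C)`
consists of the indices `< C.depth`. -/
def Ctx.depth : Ctx S → ℕ
  | .hole => 0
  | .con _ _ _ C => C.depth
  | .fn _ _ _ C => C.depth
  | .letL C _ => C.depth
  | .letR _ C => C.depth + 1

/-- The approximation ordering: the least reflexive transitive relation with `⊥ ⊑ e` that is
closed under contexts (it is antisymmetric, so it is the least such partial ordering). -/
inductive Approx : LExp S → LExp S → Prop where
  | refl (e : LExp S) : Approx e e
  | trans {e₁ e₂ e₃ : LExp S} : Approx e₁ e₂ → Approx e₂ e₃ → Approx e₁ e₃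
  | bot (e : LExp S) : Approx LExp.bot e
  | ctx (C : Ctx S) {e e' : LExp S} : Approx e e' → Approx (C.fill e) (C.fill e')

/-- The downward closure `E↓`. -/
def downClosure (E : Set (LExp S)) : Set (LExp S) := {e' | ∃ e ∈ E, Approx e' e}

/-- Program rules `f(p₁, …, pₙ) → r`: the `pᵢ` form a linear tuple of c-terms and `r ∈ LExp`.
Extra variables in `r` are allowed. -/
structure Rule (S : Signature.{u, v}) where
  f : S.FS
  pat : Fin (S.farity f) → LExp S
  rhs : LExp S
  pat_cterm : ∀ i, (pat i).IsCTerm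
  linear : ∀ x, ∑ i, (pat i).occ x ≤ 1
  rhs_total : rhs.Total

/-- A program is any set of program rules. -/
abbrev Program (S : Signature.{u, v}) := Set (Rule S)

/-- A program without lets. -/
def Program.NoLets (P : Program S) : Prop := ∀ R ∈ P, R.rhs.LetFree

/-- Partial c-substitutions (`CSubst_⊥`). Finiteness of the domain is not imposed, since only the
values at the finitely many free variables of an expression matter. -/
abbrev PCSubst (S : Signature.{u, v}) := {θ : ℕ → LExp S // ∀ x, (θ x).IsPCTerm}

/-- Derivability `P ⊢_CRWL e ⇾ t` (meant for let-free `P` and `e`). -/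
inductive CRWL (P : Program S) : LExp S → LExp S → Prop where
  | B (e : LExp S) : CRWL P e bot
  | RR (x : ℕ) : CRWL P (var x) (var x)
  | DC (c : S.CS) (e t : Fin (S.carity c) → LExp S) :
      (∀ i, CRWL P (e i) (t i)) → CRWL P (con c e) (con c t)
  | OR (R : Rule S) (θ : PCSubst S) (e : Fin (S.farity R.f) → LExp S) (t : LExp S) :
      R ∈ P → (∀ i, CRWL P (e i) ((R.pat i).subst θ.1)) → CRWL P (R.rhs.subst θ.1) t →
      CRWL P (fn R.f e) t

/-- Derivability `P ⊢_CRWL_let e ⇾ t`. -/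
inductive CRWLlet (P : Program S) : LExp S → LExp S → Prop where
  | B (e : LExp S) : CRWLlet P e bot
  | RR (x : ℕ) : CRWLlet P (var x) (var x)
  | DC (c : S.CS) (e t : Fin (S.carity c) → LExp S) :
      (∀ i, CRWLlet P (e i) (t i)) → CRWLlet P (con c e) (con c t)
  | OR (R : Rule S) (θ : PCSubst S) (e : Fin (S.farity R.f) → LExp S) (t : LExp S) :
      R ∈ P → (∀ i, CRWLlet P (e i) ((R.pat i).subst θ.1)) → CRWLlet P (R.rhs.subst θ.1) t →
      CRWLlet P (fn R.f e) t
  | Let (e₁ e₂ t₁ t : LExp S) :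
      t₁.IsPCTerm → CRWLlet P e₁ t₁ → CRWLlet P (e₂.inst t₁) t → CRWLlet P (letIn e₁ e₂) t

/-- The `CRWL_let`-denotation of `e`, a set of partial c-terms. -/
def den (P : Program S) (e : LExp S) : Set (LExp S) := {t | t.IsPCTerm ∧ CRWLlet P e t}

/-- The hyperdenotation of `e`. -/
def hyperDen (P : Program S) (e : LExp S) : PCSubst S → Set (LExp S) :=
  fun θ => den P (e.subst θ.1)

/-- The let-rewriting rules other than (Contx), for a redex below `k` enclosing let-binders.
`T` is the set of c-terms that may be propagated: `CTerm` for let-rewriting on `LExp`, and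
`CTerm_⊥` for let-rewriting on `LExp_⊥`, where `⊥` is one more constructor symbol of arity `0`.
The last condition of `fapp` says that no variable occurring in the instance of a variable outside
`p₁, …, pₙ` is bound by the context; it is void for `k = 0`. -/
inductive RootStep (P : Program S) (T : LExp S → Prop) (k : ℕ) : LExp S → LExp S → Prop where
  | fapp (R : Rule S) (θ : ℕ → LExp S) : R ∈ P → (∀ x, T (θ x)) →
      (∀ x, (∀ i, x ∉ (R.pat i).FV) → ∀ y ∈ (θ x).FV, k ≤ y) →
      RootStep P T k (fn R.f fun i => (R.pat i).subst θ) (R.rhs.subst θ)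
  | letInCon (c : S.CS) (i : Fin (S.carity c)) (args : Fin (S.carity c) → LExp S) :
      (args i).Suspendable →
      RootStep P T k (con c args)
        (letIn (args i) (con c (Function.update (fun j => (args j).shift) i (var 0))))
  | letInFn (f : S.FS) (i : Fin (S.farity f)) (args : Fin (S.farity f) → LExp S) :
      (args i).Suspendable →
      RootStep P T k (fn f args)
        (letIn (args i) (fn f (Function.update (fun j => (args j).shift) i (var 0))))
  | bind (t e : LExp S) : T t → RootStep P T k (letIn t e) (e.inst t)
  /-- `let X = e₁ in e₂` with `X ∉ FV(e₂)`: such bodies are the shifted expressions. -/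
  | elim (e₁ e₂ : LExp S) : RootStep P T k (letIn e₁ e₂.shift) e₂
  /-- `let X = (let Y = e₁ in e₂) in e₃` goes to `let Y = e₁ in let X = e₂ in e₃`; in the result
  `e₃` lies below the additional binder of `Y`, which is fresh for it. -/
  | flat (e₁ e₂ e₃ : LExp S) :
      RootStep P T k (letIn (letIn e₁ e₂) e₃) (letIn e₁ (letIn e₂ (ren (liftRen Nat.succ) e₃)))

/-- One let-rewriting step in a (possibly empty) context. -/
def Step (P : Program S) (T : LExp S → Prop) (e e' : LExp S) : Prop :=
  ∃ (C : Ctx S) (a a' : LExp S), RootStep P T C.depth a a' ∧ e = C.fill a ∧ e' = C.fill a'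

/-- `e →* e'` for the let-rewriting relation on `LExp`. -/
def LetRewrites (P : Program S) : LExp S → LExp S → Prop :=
  Relation.ReflTransGen (Step P IsCTerm)

/-- `e →* e'` for the let-rewriting relation on `LExp_⊥`. -/
def PLetRewrites (P : Program S) : LExp S → LExp S → Prop :=
  Relation.ReflTransGen (Step P IsPCTerm)

end LetRw

namespace LetRw

open LExp

universe u v

variable {S : Signature.{u, v}}

namespace LExp

/-! Soundness: a rewriting step can only shrink the hyperdenotation (`HyperLe.of_rootStep`).
Comparing under all partial c-substitutions, not just plain denotations, is what lets the inclusion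
pass below binders (`HyperLe.fill`). The shell of a reduct is one of its values (`CRWLlet.shell`)
and values are downward closed (`CRWLlet.mono`), so everything below such a shell is a value of the
original expression.

Completeness is an induction on derivations (`CRWLlet.exists_steps`): each value lies below the
shell of some reduct. The obstacle is Fapp, which needs c-terms as arguments, whereas evaluated
arguments may still contain calls and lets. Peeling (`peels_subst`) turns an expression, by LetIn,
Flat and Bind, into a chain of bindings over a body that is a c-term or a function call. A call has
shell `⊥`, so naming it by a let variable loses no information. The c-terms so obtained lie above
the required pattern instances, hence match by linearity (`Rule.exists_match`). Redexes sink below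
more and more bindings, so the statements carry the number `k` of enclosing binders and shift values
past them.

C-terms are maximal for the ordering, so a c-term value is itself the shell of a reduct, and Elim
drops the remaining bindings (`steps_shell`). The proposition `b` treats `LExp` and `LExp_⊥`
together. -/

/-- Extension of a substitution by a value for the innermost variable. -/
def scons (t : LExp S) (σ : ℕ → LExp S) : ℕ → LExp S
  | 0 => t
  | n + 1 => σ n

/-! ### Algebra of renamings and substitutions -/

theorem liftRen_comp (ρ ρ' : ℕ → ℕ) : liftRen ρ ∘ liftRen ρ' = liftRen (ρ ∘ ρ') := by
  funext n; cases n <;> rfl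

theorem ren_ren (ρ ρ' : ℕ → ℕ) (e : LExp S) : ren ρ (ren ρ' e) = ren (ρ ∘ ρ') e := by
  induction e generalizing ρ ρ' with
  | var n => rfl
  | bot => rfl
  | con c args ih => simp only [ren, ih]
  | fn f args ih => simp only [ren, ih]
  | letIn e₁ e₂ ih₁ ih₂ => simp only [ren, ih₁, ih₂, liftRen_comp]

theorem up_comp_liftRen (σ : ℕ → LExp S) (ρ : ℕ → ℕ) : up σ ∘ liftRen ρ = up (σ ∘ ρ) := by
  funext n; cases n <;> rfl

theorem subst_ren (σ : ℕ → LExp S) (ρ : ℕ → ℕ) (e : LExp S) :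
    subst σ (ren ρ e) = subst (σ ∘ ρ) e := by
  induction e generalizing σ ρ with
  | var n => rfl
  | bot => rfl
  | con c args ih => simp only [ren, subst, ih]
  | fn f args ih => simp only [ren, subst, ih]
  | letIn e₁ e₂ ih₁ ih₂ => simp only [ren, subst, ih₁, ih₂, up_comp_liftRen]

theorem ren_comp_up (ρ : ℕ → ℕ) (σ : ℕ → LExp S) :
    (fun n => ren (liftRen ρ) (up σ n)) = up fun n => ren ρ (σ n) := by
  funext n
  cases n with
  | zero => rfl
  | succ n => simp only [up, shift, ren_ren]; rfl

theorem ren_subst (ρ : ℕ → ℕ) (σ : ℕ → LExp S) (e : LExp S) :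
    ren ρ (subst σ e) = subst (fun n => ren ρ (σ n)) e := by
  induction e generalizing σ ρ with
  | var n => rfl
  | bot => rfl
  | con c args ih => simp only [ren, subst, ih]
  | fn f args ih => simp only [ren, subst, ih]
  | letIn e₁ e₂ ih₁ ih₂ => simp only [ren, subst, ih₁, ih₂, ren_comp_up]

theorem subst_comp_up (τ σ : ℕ → LExp S) :
    (fun n => subst (up τ) (up σ n)) = up fun n => subst τ (σ n) := by
  funext n
  cases n with
  | zero => rfl
  | succ n => simp only [up, shift, subst_ren, ren_subst]; rfl

theorem subst_subst (τ σ : ℕ → LExp S) (e : LExp S) :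
    subst τ (subst σ e) = subst (fun n => subst τ (σ n)) e := by
  induction e generalizing σ τ with
  | var n => rfl
  | bot => rfl
  | con c args ih => simp only [subst, ih]
  | fn f args ih => simp only [subst, ih]
  | letIn e₁ e₂ ih₁ ih₂ => simp only [subst, ih₁, ih₂, subst_comp_up]

theorem up_var : up (var : ℕ → LExp S) = var := by
  funext n; cases n <;> rfl

theorem subst_var (e : LExp S) : subst var e = e := by
  induction e with
  | var n => rfl
  | bot => rfl
  | con c args ih => simp only [subst, ih]
  | fn f args ih => simp only [subst, ih]
  | letIn e₁ e₂ ih₁ ih₂ => simp only [subst, ih₁, ih₂, up_var]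

theorem ren_eq_subst (ρ : ℕ → ℕ) (e : LExp S) : ren ρ e = subst (fun n => var (ρ n)) e := by
  rw [← subst_var (ren ρ e), subst_ren]; rfl

theorem ren_id (e : LExp S) : ren id e = e := by
  rw [ren_eq_subst]; exact subst_var e

theorem single_eq (t : LExp S) : single t = scons t var := by
  funext n; cases n <;> rfl

theorem subst_scons_up (t : LExp S) (τ σ : ℕ → LExp S) :
    (fun n => subst (scons t τ) (up σ n)) = scons t fun n => subst τ (σ n) := by
  funext n
  cases n with
  | zero => rfl
  | succ n => simp only [up, shift, subst_ren]; rfl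

/-- Giving the bound variable its value after substituting under the binder amounts to one extended
substitution; inductions over all substitutions get through lets this way. -/
theorem subst_up_inst (σ : ℕ → LExp S) (e t : LExp S) :
    (subst (up σ) e).inst t = subst (scons t σ) e := by
  rw [inst, subst_subst, single_eq, subst_scons_up]
  simp only [subst_var]

theorem subst_inst (σ : ℕ → LExp S) (e t : LExp S) :
    subst σ (e.inst t) = (subst (up σ) e).inst (subst σ t) := by
  rw [subst_up_inst, inst, subst_subst]
  congr 1; funext n; cases n <;> rfl

theorem shift_inst (e t : LExp S) : e.shift.inst t = e := by
  rw [shift, inst, subst_ren]; exact subst_var e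

theorem ren_inst (ρ : ℕ → ℕ) (e t : LExp S) :
    ren ρ (e.inst t) = (ren (liftRen ρ) e).inst (ren ρ t) := by
  simp only [inst, ren_subst, subst_ren]
  congr 1; funext n; cases n <;> rfl

theorem subst_up_shift (σ : ℕ → LExp S) (e : LExp S) :
    subst (up σ) e.shift = (subst σ e).shift := by
  simp only [shift, subst_ren, ren_subst]; rfl

theorem subst_congr {σ τ : ℕ → LExp S} {e : LExp S} (h : ∀ x ∈ e.FV, σ x = τ x) :
    subst σ e = subst τ e := by
  induction e generalizing σ τ with
  | var n => exact h n (by simp [FV, occ])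
  | bot => rfl
  | con c args ih =>
    simp only [subst]; congr 1; funext i
    exact ih i fun x hx => h x (by
      simp only [FV, Set.mem_ofPred_eq, occ] at hx ⊢
      exact lt_of_lt_of_le hx
        (Finset.single_le_sum (f := fun i => (args i).occ x) (fun _ _ => Nat.zero_le _)
          (Finset.mem_univ i)))
  | fn f args ih =>
    simp only [subst]; congr 1; funext i
    exact ih i fun x hx => h x (by
      simp only [FV, Set.mem_ofPred_eq, occ] at hx ⊢
      exact lt_of_lt_of_le hx
        (Finset.single_le_sum (f := fun i => (args i).occ x) (fun _ _ => Nat.zero_le _)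
          (Finset.mem_univ i)))
  | letIn e₁ e₂ ih₁ ih₂ =>
    simp only [FV, Set.mem_ofPred_eq, occ] at h ih₁ ih₂
    simp only [subst]
    rw [ih₁ fun x hx => h x (by omega), ih₂ (τ := up τ)]
    intro x hx
    cases x with
    | zero => rfl
    | succ x => simp only [up]; rw [h x (by omega)]

/-! ### Partial c-terms and totality -/

theorem IsPCTerm.ren {t : LExp S} (h : t.IsPCTerm) (ρ : ℕ → ℕ) : (ren ρ t).IsPCTerm := by
  induction t with
  | var n => trivial
  | bot => trivial
  | con c args ih => exact fun i => ih i (h i)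
  | fn f args ih => exact h
  | letIn e₁ e₂ ih₁ ih₂ => exact h

theorem IsPCTerm.subst {t : LExp S} (h : t.IsPCTerm) {σ : ℕ → LExp S}
    (hσ : ∀ x, (σ x).IsPCTerm) : (subst σ t).IsPCTerm := by
  induction t with
  | var n => exact hσ n
  | bot => trivial
  | con c args ih => exact fun i => ih i (h i)
  | fn f args ih => exact h
  | letIn e₁ e₂ ih₁ ih₂ => exact h

theorem Total.ren {e : LExp S} (h : e.Total) (ρ : ℕ → ℕ) : (ren ρ e).Total := by
  induction e generalizing ρ with
  | var n => trivial
  | bot => exact h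
  | con c args ih => exact fun i => ih i (h i) ρ
  | fn f args ih => exact fun i => ih i (h i) ρ
  | letIn e₁ e₂ ih₁ ih₂ => exact ⟨ih₁ h.1 _, ih₂ h.2 _⟩

theorem Total.of_ren {e : LExp S} {ρ : ℕ → ℕ} (h : (LExp.ren ρ e).Total) : e.Total := by
  induction e generalizing ρ with
  | var n => trivial
  | bot => exact h
  | con c args ih => exact fun i => ih i (h i)
  | fn f args ih => exact fun i => ih i (h i)
  | letIn e₁ e₂ ih₁ ih₂ => exact ⟨ih₁ h.1, ih₂ h.2⟩

theorem Total.subst {e : LExp S} (h : e.Total) {σ : ℕ → LExp S}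
    (hσ : ∀ x, (σ x).Total) : (subst σ e).Total := by
  induction e generalizing σ with
  | var n => exact hσ n
  | bot => exact h
  | con c args ih => exact fun i => ih i (h i) hσ
  | fn f args ih => exact fun i => ih i (h i) hσ
  | letIn e₁ e₂ ih₁ ih₂ =>
    refine ⟨ih₁ h.1 hσ, ih₂ h.2 fun x => ?_⟩
    cases x with
    | zero => trivial
    | succ x => exact (hσ x).ren _

theorem LetFree.subst {e : LExp S} (h : e.LetFree) {σ : ℕ → LExp S}
    (hσ : ∀ x, (σ x).LetFree) : (subst σ e).LetFree := by
  induction e generalizing σ with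
  | var n => exact hσ n
  | bot => trivial
  | con c args ih => exact fun i => ih i (h i) hσ
  | fn f args ih => exact fun i => ih i (h i) hσ
  | letIn e₁ e₂ ih₁ ih₂ => exact h.elim

theorem IsPCTerm.letFree {t : LExp S} (h : t.IsPCTerm) : t.LetFree := by
  induction t with
  | var n => trivial
  | bot => trivial
  | con c args ih => exact fun i => ih i (h i)
  | fn f args ih => exact h.elim
  | letIn e₁ e₂ ih₁ ih₂ => exact h

theorem isPCTerm_scons {t : LExp S} (ht : t.IsPCTerm) {σ : ℕ → LExp S}
    (hσ : ∀ x, (σ x).IsPCTerm) : ∀ x, (scons t σ x).IsPCTerm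
  | 0 => ht
  | x + 1 => hσ x

theorem isPCTerm_up {σ : ℕ → LExp S} (hσ : ∀ x, (σ x).IsPCTerm) : ∀ x, (up σ x).IsPCTerm
  | 0 => trivial
  | x + 1 => (hσ x).ren _

theorem isPCTerm_single {t : LExp S} (ht : t.IsPCTerm) : ∀ x, (single t x).IsPCTerm
  | 0 => ht
  | _ + 1 => trivial

/-! ### Shells -/

theorem isPCTerm_shell (e : LExp S) : e.shell.IsPCTerm := by
  induction e with
  | var n => trivial
  | bot => trivial
  | con c args ih => exact ih
  | fn f args ih => trivial
  | letIn e₁ e₂ ih₁ ih₂ => exact ih₂.subst (isPCTerm_single ih₁)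

theorem IsPCTerm.shell_eq {t : LExp S} (h : t.IsPCTerm) : t.shell = t := by
  induction t with
  | var n => rfl
  | bot => rfl
  | con c args ih => simp only [shell]; congr 1; funext i; exact ih i (h i)
  | fn f args ih => exact h.elim
  | letIn e₁ e₂ ih₁ ih₂ => exact h.elim

theorem shell_subst (e : LExp S) {σ : ℕ → LExp S} (hσ : ∀ x, (σ x).IsPCTerm) :
    (subst σ e).shell = subst σ e.shell := by
  induction e generalizing σ with
  | var n => exact (hσ n).shell_eq
  | bot => rfl
  | con c args ih => simp only [shell, subst, ih _ hσ]
  | fn f args ih => rfl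
  | letIn e₁ e₂ ih₁ ih₂ =>
    simp only [shell, subst, ih₁ hσ, ih₂ (isPCTerm_up hσ), subst_inst]

theorem shell_ren (e : LExp S) (ρ : ℕ → ℕ) : (ren ρ e).shell = ren ρ e.shell := by
  rw [ren_eq_subst, ren_eq_subst, shell_subst]; exact fun _ => trivial

end LExp

/-! ### The structural approximation ordering -/

/-- The approximation ordering, defined by recursion on the structure of expressions. -/
inductive Le : LExp S → LExp S → Prop where
  | bot (e : LExp S) : Le LExp.bot e
  | var (n : ℕ) : Le (LExp.var n) (LExp.var n)
  | con (c : S.CS) {a a' : Fin (S.carity c) → LExp S} :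
      (∀ i, Le (a i) (a' i)) → Le (LExp.con c a) (LExp.con c a')
  | fn (f : S.FS) {a a' : Fin (S.farity f) → LExp S} :
      (∀ i, Le (a i) (a' i)) → Le (LExp.fn f a) (LExp.fn f a')
  | letIn {e₁ e₁' e₂ e₂' : LExp S} :
      Le e₁ e₁' → Le e₂ e₂' → Le (LExp.letIn e₁ e₂) (LExp.letIn e₁' e₂')

namespace Le

theorem refl (e : LExp S) : Le e e := by
  induction e with
  | var n => exact .var n
  | bot => exact .bot _
  | con c args ih => exact .con c ih
  | fn f args ih => exact .fn f ih
  | letIn e₁ e₂ ih₁ ih₂ => exact .letIn ih₁ ih₂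

theorem trans {e₁ e₂ e₃ : LExp S} (h : Le e₁ e₂) (h' : Le e₂ e₃) : Le e₁ e₃ := by
  induction h generalizing e₃ with
  | bot e => exact .bot _
  | var n => exact h'
  | con c h ih => cases h' with | con _ h' => exact .con c fun i => ih i (h' i)
  | fn f h ih => cases h' with | fn _ h' => exact .fn f fun i => ih i (h' i)
  | letIn h₁ h₂ ih₁ ih₂ => cases h' with | letIn h₁' h₂' => exact .letIn (ih₁ h₁') (ih₂ h₂')

theorem ren {e e' : LExp S} (h : Le e e') (ρ : ℕ → ℕ) : Le (ren ρ e) (ren ρ e') := by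
  induction h generalizing ρ with
  | bot e => exact .bot _
  | var n => exact .var _
  | con c h ih => exact .con c fun i => ih i ρ
  | fn f h ih => exact .fn f fun i => ih i ρ
  | letIn h₁ h₂ ih₁ ih₂ => exact .letIn (ih₁ _) (ih₂ _)

theorem subst {e e' : LExp S} (h : Le e e') {σ σ' : ℕ → LExp S} (hσ : ∀ x, Le (σ x) (σ' x)) :
    Le (subst σ e) (subst σ' e') := by
  induction h generalizing σ σ' with
  | bot e => exact .bot _
  | var n => exact hσ n
  | con c h ih => exact .con c fun i => ih i hσ
  | fn f h ih => exact .fn f fun i => ih i hσ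
  | letIn h₁ h₂ ih₁ ih₂ =>
    refine .letIn (ih₁ hσ) (ih₂ fun x => ?_)
    cases x with
    | zero => exact .var 0
    | succ x => exact (hσ x).ren _

theorem inst {e e' t t' : LExp S} (h : Le e e') (ht : Le t t') : Le (e.inst t) (e'.inst t') :=
  h.subst fun x => by
    cases x with
    | zero => exact ht
    | succ x => exact .var x

theorem fill (C : Ctx S) {e e' : LExp S} (h : Le e e') : Le (C.fill e) (C.fill e') := by
  induction C with
  | hole => exact h
  | con c i args C ih =>
    refine .con c fun j => ?_
    by_cases hj : j = i
    · subst hj; simpa using ih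
    · simpa [hj] using refl _
  | fn f i args C ih =>
    refine .fn f fun j => ?_
    by_cases hj : j = i
    · subst hj; simpa using ih
    · simpa [hj] using refl _
  | letL C e ih => exact .letIn ih (refl _)
  | letR e C ih => exact .letIn (refl _) ih

theorem of_approx {e e' : LExp S} (h : Approx e e') : Le e e' := by
  induction h with
  | refl e => exact refl e
  | trans _ _ ih₁ ih₂ => exact ih₁.trans ih₂
  | bot e => exact .bot e
  | ctx C _ ih => exact ih.fill C

/-- Only an occurrence of `⊥` can be strictly enlarged, so c-terms are maximal. -/
theorem eq_of_isCTerm {t t' : LExp S} (h : Le t t') (ht : t.IsCTerm) : t = t' := by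
  induction h with
  | bot e => exact ht.2.elim
  | var n => rfl
  | con c h ih => congr 1; funext i; exact ih i ⟨ht.1 i, ht.2 i⟩
  | fn f h ih => exact ht.1.elim
  | letIn h₁ h₂ ih₁ ih₂ => exact ht.1.elim

end Le

/-- A relation on argument tuples that may be changed one argument at a time may be changed at
all arguments. -/
theorem pi_induction {n : ℕ} {α : Type*} {r : α → α → Prop} {R : (Fin n → α) → (Fin n → α) → Prop}
    (hrefl : ∀ a, R a a) (htrans : ∀ a b c, R a b → R b c → R a c)
    (hstep : ∀ a i x, r (a i) x → R a (Function.update a i x))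
    {a a' : Fin n → α} (h : ∀ i, r (a i) (a' i)) : R a a' := by
  -- The coordinates in `s` have already been switched to `a'`.
  have key : ∀ s : Finset (Fin n), R a (fun i => if i ∈ s then a' i else a i) := by
    intro s
    induction s using Finset.induction_on with
    | empty => simpa using hrefl a
    | insert i s hi ih =>
      refine htrans _ _ _ ih ?_
      have := hstep (fun i => if i ∈ s then a' i else a i) i (a' i) (by simpa [hi] using h i)
      convert this using 1
      funext j
      by_cases hj : j = i
      · subst hj; simp
      · simp [hj]
  simpa using key Finset.univ

theorem Le.approx {e e' : LExp S} (h : Le e e') : Approx e e' := by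
  induction h with
  | bot e => exact .bot e
  | var n => exact .refl _
  | con c h ih =>
    refine pi_induction (r := Approx) (R := fun a a' => Approx (LExp.con c a) (LExp.con c a'))
      (fun _ => .refl _) (fun _ _ _ => .trans) (fun a i x hx => ?_) ih
    simpa [Ctx.fill] using Approx.ctx (.con c i a .hole) hx
  | fn f h ih =>
    refine pi_induction (r := Approx) (R := fun a a' => Approx (LExp.fn f a) (LExp.fn f a'))
      (fun _ => .refl _) (fun _ _ _ => .trans) (fun a i x hx => ?_) ih
    simpa [Ctx.fill] using Approx.ctx (.fn f i a .hole) hx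
  | @letIn e₁ e₁' e₂ e₂' h₁ h₂ ih₁ ih₂ =>
    exact .trans (Approx.ctx (.letL .hole e₂) ih₁) (Approx.ctx (.letR e₁' .hole) ih₂)

/-! ### Properties of the calculus -/

namespace CRWLlet

variable {P : Program S}

theorem isPCTerm {e t : LExp S} (h : CRWLlet P e t) : t.IsPCTerm := by
  induction h with
  | B e => trivial
  | RR x => trivial
  | DC c e t h ih => exact ih
  | OR R θ e t hR h₁ h₂ ih₁ ih₂ => exact ih₂
  | Let e₁ e₂ t₁ t ht₁ h₁ h₂ ih₁ ih₂ => exact ih₂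

theorem self {t : LExp S} (h : t.IsPCTerm) : CRWLlet P t t := by
  induction t with
  | var n => exact .RR n
  | bot => exact .B _
  | con c args ih => exact .DC c _ _ fun i => ih i (h i)
  | fn f args ih => exact h.elim
  | letIn e₁ e₂ ih₁ ih₂ => exact h.elim

theorem le_of_isPCTerm {t s : LExp S} (h : CRWLlet P t s) (ht : t.IsPCTerm) : Le s t := by
  induction h with
  | B e => exact .bot _
  | RR x => exact .var x
  | DC c e t h ih => exact .con c fun i => ih i (ht i)
  | OR R θ e t hR h₁ h₂ ih₁ ih₂ => exact ht.elim
  | Let e₁ e₂ t₁ t ht₁ h₁ h₂ ih₁ ih₂ => exact ht.elim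

/-- Denotations are downward closed, and monotone in the expression. -/
theorem mono {e t : LExp S} (h : CRWLlet P e t) {e' t' : LExp S} (he : Le e e') (ht : Le t' t) :
    CRWLlet P e' t' := by
  induction h generalizing e' t' with
  | B e => cases ht; exact .B _
  | RR x => cases he; cases ht <;> constructor
  | DC c e t h ih =>
    cases he with | con _ he =>
    cases ht with
    | bot => exact .B _
    | con _ ht => exact .DC c _ _ fun i => ih i (he i) (ht i)
  | OR R θ e t hR h₁ h₂ ih₁ ih₂ =>
    cases he with | fn _ he =>
    exact .OR R θ _ _ hR (fun i => ih₁ i (he i) (.refl _)) (ih₂ (.refl _) ht)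
  | Let e₁ e₂ t₁ t ht₁ h₁ h₂ ih₁ ih₂ =>
    cases he with | letIn he₁ he₂ =>
    exact .Let _ _ t₁ _ ht₁ (ih₁ he₁ (.refl _)) (ih₂ (he₂.inst (.refl _)) ht)

/-- An argument tuple may be replaced by one with larger denotations. -/
theorem fn_mono {f : S.FS} {a a' : Fin (S.farity f) → LExp S} {t : LExp S}
    (h : CRWLlet P (fn f a) t) (ha : ∀ i s, CRWLlet P (a i) s → CRWLlet P (a' i) s) :
    CRWLlet P (fn f a') t := by
  -- In `OR` the symbol is `R.f`, which cannot be unified with `f` directly; the equation is split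
  -- by hand.
  generalize hx : fn f a = x at h
  cases h with
  | B e => exact .B _
  | RR x => cases hx
  | DC c e t h => cases hx
  | OR R θ e t hR h₁ h₂ =>
    injection hx with hf hae
    subst hf
    cases eq_of_heq hae
    exact .OR R θ _ _ hR (fun i => ha i _ (h₁ i)) h₂
  | Let e₁ e₂ t₁ t ht₁ h₁ h₂ => cases hx

theorem con_mono {c : S.CS} {a a' : Fin (S.carity c) → LExp S} {t : LExp S}
    (h : CRWLlet P (con c a) t) (ha : ∀ i s, CRWLlet P (a i) s → CRWLlet P (a' i) s) :
    CRWLlet P (con c a') t := by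
  cases h with
  | B e => exact .B _
  | DC c e t h => exact .DC c _ _ fun i => ha i _ (h i)

/-- The substitution must vary: in a let, the bound variable receives the shell of the definiens,
and the body is treated under the extended substitution. -/
theorem subst_shell (e : LExp S) {σ : ℕ → LExp S} (hσ : ∀ x, (σ x).IsPCTerm) :
    CRWLlet P (subst σ e) (subst σ e).shell := by
  induction e generalizing σ with
  | var n =>
    simp only [LExp.subst]
    rw [(hσ n).shell_eq]; exact self (hσ n)
  | bot => exact .B _
  | con c args ih => exact .DC c _ _ fun i => ih i hσ
  | fn f args ih => exact .B _
  | letIn e₁ e₂ ih₁ ih₂ =>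
    refine .Let _ _ _ _ (isPCTerm_shell _) (ih₁ hσ) ?_
    have := ih₂ (isPCTerm_scons (isPCTerm_shell (LExp.subst σ e₁)) hσ)
    rw [← subst_up_inst] at this
    rwa [inst, shell_subst _ (isPCTerm_single (isPCTerm_shell _))] at this

theorem shell (e : LExp S) : CRWLlet P e e.shell := by
  simpa only [subst_var] using subst_shell (P := P) e (σ := var) fun _ => trivial

end CRWLlet

/-! ### Soundness of let-rewriting -/

/-- The hyperdenotation of `a'` is pointwise included in that of `a`. -/
def HyperLe (P : Program S) (a' a : LExp S) : Prop :=
  ∀ θ : ℕ → LExp S, (∀ x, (θ x).IsPCTerm) → ∀ t,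
    CRWLlet P (subst θ a') t → CRWLlet P (subst θ a) t

/-- Below a let the hole is evaluated with the bound variable replaced by some value, that is, under
an extended substitution, which the hypothesis covers. -/
theorem HyperLe.fill {P : Program S} (C : Ctx S) {a a' : LExp S} (h : HyperLe P a' a) :
    HyperLe P (C.fill a') (C.fill a) := by
  induction C with
  | hole => exact h
  | con c i args C ih =>
    intro θ hθ t ht
    refine CRWLlet.con_mono ht fun j s hs => ?_
    by_cases hj : j = i
    · subst hj; simp only [Function.update_self] at hs ⊢; exact ih θ hθ s hs
    · simpa [hj] using hs
  | fn f i args C ih =>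
    intro θ hθ t ht
    refine CRWLlet.fn_mono ht fun j s hs => ?_
    by_cases hj : j = i
    · subst hj; simp only [Function.update_self] at hs ⊢; exact ih θ hθ s hs
    · simpa [hj] using hs
  | letL C e ih =>
    intro θ hθ t ht
    cases ht with
    | B => exact .B _
    | Let _ _ t₁ _ ht₁ h₁ h₂ => exact .Let _ _ t₁ _ ht₁ (ih θ hθ _ h₁) h₂
  | letR e C ih =>
    intro θ hθ t ht
    cases ht with
    | B => exact .B _
    | Let _ _ t₁ _ ht₁ h₁ h₂ =>
      refine .Let _ _ t₁ _ ht₁ h₁ ?_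
      rw [subst_up_inst] at h₂ ⊢
      exact ih _ (isPCTerm_scons ht₁ hθ) _ h₂

theorem subst_up_update {n : ℕ} (θ : ℕ → LExp S) (t : LExp S) (args : Fin n → LExp S)
    (i j : Fin n) :
    (subst (up θ) (Function.update (fun j => (args j).shift) i (var 0) j)).inst t =
      Function.update (fun j => subst θ (args j)) i t j := by
  by_cases hj : j = i
  · subst hj; simp [subst, up, inst, single]
  · simp [hj, subst_up_shift, shift_inst]

theorem HyperLe.of_rootStep {P : Program S} {T : LExp S → Prop} (hT : ∀ t, T t → t.IsPCTerm)
    {k : ℕ} {a a' : LExp S} (h : RootStep P T k a a') : HyperLe P a' a := by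
  intro θ hθ t ht
  -- Soundness of LetIn: the abstracted argument now yields only approximations of the shared value
  -- `t₁`, all of which the original argument yields by downward closure.
  have args_le : ∀ {n : ℕ} (args : Fin n → LExp S) (i : Fin n) (t₁ : LExp S), t₁.IsPCTerm →
      CRWLlet P (subst θ (args i)) t₁ → ∀ j s,
      CRWLlet P ((subst (up θ) (Function.update (fun j => (args j).shift) i (var 0) j)).inst t₁) s →
      CRWLlet P (subst θ (args j)) s := by
    intro n args i t₁ ht₁ h₁ j s hs
    rw [subst_up_update] at hs
    by_cases hj : j = i
    · subst hj
      rw [Function.update_self] at hs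
      exact h₁.mono (.refl _) (hs.le_of_isPCTerm ht₁)
    · simpa [hj] using hs
  cases h with
  | fapp R σ hR hσ _ =>
    have hσθ : ∀ x, (subst θ (σ x)).IsPCTerm := fun x => (hT _ (hσ x)).subst hθ
    refine CRWLlet.OR R ⟨_, hσθ⟩ _ _ hR (fun i => ?_) (by rwa [subst_subst] at ht)
    dsimp only
    rw [subst_subst]
    exact .self ((R.pat_cterm i).1.subst hσθ)
  | letInCon c i args _ =>
    cases ht with
    | B => exact .B _
    | Let _ _ t₁ _ ht₁ h₁ h₂ => exact CRWLlet.con_mono h₂ (args_le args i t₁ ht₁ h₁)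
  | letInFn f i args _ =>
    cases ht with
    | B => exact .B _
    | Let _ _ t₁ _ ht₁ h₁ h₂ => exact CRWLlet.fn_mono h₂ (args_le args i t₁ ht₁ h₁)
  | bind t₁ e ht₁ =>
    have := (hT _ ht₁).subst hθ
    rw [subst_inst] at ht
    exact .Let _ _ _ _ this (.self this) ht
  | elim e₁ e₂ =>
    -- The discarded binding needs no evaluation, so `⊥` serves as its value.
    refine .Let _ _ bot _ trivial (.B _) ?_
    rwa [subst_up_shift, shift_inst]
  | flat e₁ e₂ e₃ =>
    cases ht with
    | B => exact .B _
    | Let _ _ t₁ _ ht₁ h₁ h₂ =>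
      cases h₂ with
      | B => exact .B _
      | Let _ _ t₂ _ ht₂ h₂ h₃ =>
        refine .Let _ _ t₂ _ ht₂ (.Let _ _ t₁ _ ht₁ h₁ h₂) ?_
        -- The renaming of `e₃` skips `Y`, so the value `t₁` of `Y` never reaches it.
        convert h₃ using 1
        simp only [inst, subst_subst, subst_ren]
        congr 1
        funext n
        cases n with
        | zero => rfl
        | succ n => simp only [Function.comp, liftRen, up, shift, subst_ren]; rfl

theorem CRWLlet.of_step {P : Program S} {T : LExp S → Prop} (hT : ∀ t, T t → t.IsPCTerm)
    {e e' t : LExp S} (h : Step P T e e') (ht : CRWLlet P e' t) : CRWLlet P e t := by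
  obtain ⟨C, a, a', hr, rfl, rfl⟩ := h
  have := (HyperLe.of_rootStep hT hr).fill C var (fun _ => trivial) t
  simp only [subst_var] at this
  exact this ht

theorem CRWLlet.of_steps {P : Program S} {T : LExp S → Prop} (hT : ∀ t, T t → t.IsPCTerm)
    {e e' t : LExp S} (h : Relation.ReflTransGen (Step P T) e e') (ht : CRWLlet P e' t) :
    CRWLlet P e t := by
  induction h using Relation.ReflTransGen.head_induction_on with
  | refl => exact ht
  | head h _ ih => exact .of_step hT h ih

/-! ### Conservativity over the calculus without lets -/

theorem CRWL.toLet {P : Program S} {e t : LExp S} (h : CRWL P e t) : CRWLlet P e t := by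
  induction h with
  | B e => exact .B e
  | RR x => exact .RR x
  | DC c e t _ ih => exact .DC c e t ih
  | OR R θ e t hR _ _ ih₁ ih₂ => exact .OR R θ e t hR ih₁ ih₂

/-- Let-freeness passes to instances of right-hand sides, as c-terms contain no lets; hence (Let)
never applies. -/
theorem CRWLlet.toCRWL {P : Program S} (hP : P.NoLets) {e t : LExp S} (h : CRWLlet P e t)
    (he : e.LetFree) : CRWL P e t := by
  induction h with
  | B e => exact .B e
  | RR x => exact .RR x
  | DC c e t _ ih => exact .DC c e t fun i => ih i (he i)
  | OR R θ e t hR _ _ ih₁ ih₂ =>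
    exact .OR R θ e t hR (fun i => ih₁ i (he i))
      (ih₂ ((hP R hR).subst fun x => (θ.2 x).letFree))
  | Let e₁ e₂ t₁ t ht₁ h₁ h₂ ih₁ ih₂ => exact he.elim

/-! ### Let-rewriting below enclosing binders -/

/-- `e` is total, or `⊥` is admitted as a constructor symbol (`b`). -/
def Adm (b : Prop) (e : LExp S) : Prop := b ∨ e.Total

/-- The c-terms that may be propagated: total unless `⊥` is admitted as a constructor (`b`). -/
def AdmCTerm (b : Prop) (t : LExp S) : Prop := t.IsPCTerm ∧ Adm b t

theorem admCTerm_false : AdmCTerm False = (IsCTerm : LExp S → Prop) := by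
  funext t; simp [AdmCTerm, Adm, IsCTerm]

theorem admCTerm_true : AdmCTerm True = (IsPCTerm : LExp S → Prop) := by
  funext t; simp [AdmCTerm, Adm]

theorem Adm.ren {b : Prop} {e : LExp S} (h : Adm b e) (ρ : ℕ → ℕ) : Adm b (ren ρ e) :=
  h.imp_right fun h => h.ren ρ

theorem AdmCTerm.ren {b : Prop} {e : LExp S} (h : AdmCTerm b e) (ρ : ℕ → ℕ) :
    AdmCTerm b (ren ρ e) := ⟨h.1.ren ρ, h.2.ren ρ⟩

theorem AdmCTerm.var (b : Prop) (n : ℕ) : AdmCTerm b (var n : LExp S) := ⟨trivial, .inr trivial⟩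

/-- One let-rewriting step of an expression that stands below `k` enclosing binders. -/
inductive StepAt (P : Program S) (T : LExp S → Prop) : ℕ → LExp S → LExp S → Prop where
  | root {k : ℕ} {a a' : LExp S} : RootStep P T k a a' → StepAt P T k a a'
  | con {k : ℕ} (c : S.CS) (i : Fin (S.carity c)) {args : Fin (S.carity c) → LExp S}
      {a' : LExp S} : StepAt P T k (args i) a' →
      StepAt P T k (LExp.con c args) (LExp.con c (Function.update args i a'))
  | fn {k : ℕ} (f : S.FS) (i : Fin (S.farity f)) {args : Fin (S.farity f) → LExp S}
      {a' : LExp S} : StepAt P T k (args i) a' →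
      StepAt P T k (LExp.fn f args) (LExp.fn f (Function.update args i a'))
  | letL {k : ℕ} {e₁ e₁' : LExp S} (e₂ : LExp S) : StepAt P T k e₁ e₁' →
      StepAt P T k (letIn e₁ e₂) (letIn e₁' e₂)
  | letR {k : ℕ} (e₁ : LExp S) {e₂ e₂' : LExp S} : StepAt P T (k + 1) e₂ e₂' →
      StepAt P T k (letIn e₁ e₂) (letIn e₁ e₂')

/-- The index `k` grows exactly at the bodies of lets, as the depth of the context does. -/
theorem StepAt.exists_ctx {P : Program S} {T : LExp S → Prop} {k : ℕ} {e e' : LExp S}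
    (h : StepAt P T k e e') : ∃ (C : Ctx S) (a a' : LExp S),
      RootStep P T (k + C.depth) a a' ∧ e = C.fill a ∧ e' = C.fill a' := by
  induction h with
  | root h => exact ⟨.hole, _, _, h, rfl, rfl⟩
  | @con k c i args a' _ ih =>
    obtain ⟨C, a, a', hr, h, rfl⟩ := ih
    exact ⟨.con c i args C, a, a', hr, by simp [Ctx.fill, ← h], rfl⟩
  | @fn k f i args a' _ ih =>
    obtain ⟨C, a, a', hr, h, rfl⟩ := ih
    exact ⟨.fn f i args C, a, a', hr, by simp [Ctx.fill, ← h], rfl⟩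
  | letL e₂ _ ih =>
    obtain ⟨C, a, a', hr, rfl, rfl⟩ := ih
    exact ⟨.letL C e₂, a, a', hr, rfl, rfl⟩
  | letR e₁ _ ih =>
    obtain ⟨C, a, a', hr, rfl, rfl⟩ := ih
    refine ⟨.letR e₁ C, a, a', ?_, rfl, rfl⟩
    rwa [Ctx.depth, ← Nat.add_assoc, Nat.add_right_comm]

theorem StepAt.step {P : Program S} {T : LExp S → Prop} {e e' : LExp S}
    (h : StepAt P T 0 e e') : Step P T e e' := by
  simpa only [Nat.zero_add, Step] using h.exists_ctx

/-- Let-rewriting of an expression that stands below `k` enclosing binders. -/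
abbrev Steps (P : Program S) (b : Prop) (k : ℕ) : LExp S → LExp S → Prop :=
  Relation.ReflTransGen (StepAt P (AdmCTerm b) k)

theorem total_update {n : ℕ} {args : Fin n → LExp S} {i : Fin n} {a : LExp S}
    (h : ∀ j, (args j).Total) (ha : a.Total) (j : Fin n) : (Function.update args i a j).Total := by
  by_cases hj : j = i
  · subst hj; simpa using ha
  · simpa [hj] using h j

theorem Total.of_rootStep {P : Program S} {T : LExp S → Prop} (hT : ∀ t, T t → t.Total) {k : ℕ}
    {a a' : LExp S} (h : RootStep P T k a a') (ha : a.Total) : a'.Total := by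
  cases h with
  | fapp R θ hR hθ _ => exact R.rhs_total.subst fun x => hT _ (hθ x)
  | letInCon c i args _ => exact ⟨ha i, total_update (fun j => (ha j).ren _) trivial⟩
  | letInFn f i args _ => exact ⟨ha i, total_update (fun j => (ha j).ren _) trivial⟩
  | bind t e ht =>
    refine ha.2.subst fun x => ?_
    cases x with
    | zero => exact ha.1
    | succ x => trivial
  | elim e₁ e₂ => exact ha.2.of_ren
  | flat e₁ e₂ e₃ => exact ⟨ha.1.1, ha.1.2, ha.2.ren _⟩

theorem Total.of_stepAt {P : Program S} {T : LExp S → Prop} (hT : ∀ t, T t → t.Total) {k : ℕ}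
    {e e' : LExp S} (h : StepAt P T k e e') (he : e.Total) : e'.Total := by
  induction h with
  | root h => exact Total.of_rootStep hT h he
  | con c i _ ih => exact total_update he (ih (he i))
  | fn f i _ ih => exact total_update he (ih (he i))
  | letL e₂ _ ih => exact ⟨ih he.1, he.2⟩
  | letR e₁ _ ih => exact ⟨he.1, ih he.2⟩

theorem Steps.adm {P : Program S} {b : Prop} {k : ℕ} {e e' : LExp S} (h : Steps P b k e e')
    (he : Adm b e) : Adm b e' := by
  by_cases hb : b
  · exact .inl hb
  · induction h with
    | refl => exact he
    | tail _ h ih =>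
      exact .inr (Total.of_stepAt (fun t ht => ht.2.resolve_left hb) h (ih.resolve_left hb))

theorem Steps.letL {P : Program S} {b : Prop} {k : ℕ} {e₁ e₁' : LExp S} (h : Steps P b k e₁ e₁')
    (e₂ : LExp S) : Steps P b k (letIn e₁ e₂) (letIn e₁' e₂) :=
  h.lift (fun e => letIn e e₂) fun _ _ => .letL e₂

theorem Steps.letR {P : Program S} {b : Prop} {k : ℕ} {e₂ e₂' : LExp S} (e₁ : LExp S)
    (h : Steps P b (k + 1) e₂ e₂') : Steps P b k (letIn e₁ e₂) (letIn e₁ e₂') :=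
  h.lift (fun e => letIn e₁ e) fun _ _ => .letR e₁

/-! ### Iterated binders -/

namespace LExp

/-- The expression `e` seen from inside `m` more binders. -/
def shiftBy (m : ℕ) (e : LExp S) : LExp S := ren (· + m) e

theorem shiftBy_zero (e : LExp S) : shiftBy 0 e = e := ren_id e

theorem shiftBy_shiftBy (m n : ℕ) (e : LExp S) : shiftBy m (shiftBy n e) = shiftBy (n + m) e := by
  simp only [shiftBy, ren_ren]
  congr 1; funext x; exact Nat.add_assoc x n m

theorem shiftBy_shift (m : ℕ) (e : LExp S) : shiftBy m e.shift = shiftBy (m + 1) e := by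
  rw [Nat.add_comm]; exact shiftBy_shiftBy m 1 e

theorem shift_shiftBy (m : ℕ) (e : LExp S) : (shiftBy m e).shift = shiftBy (m + 1) e :=
  shiftBy_shiftBy 1 m e

/-- `let X₁ = e₁ in … let Xₘ = eₘ in u`. -/
def lets : List (LExp S) → LExp S → LExp S
  | [], u => u
  | e :: es, u => letIn e (lets es u)

theorem lets_append (es es' : List (LExp S)) (u : LExp S) :
    lets (es ++ es') u = lets es (lets es' u) := by
  induction es with
  | nil => rfl
  | cons e es ih => simp only [List.cons_append, lets, ih]

/-- A value shifted past the bindings mentions none of their variables, so the substitutions made by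
the shell leave it intact. -/
theorem le_shell_lets {es : List (LExp S)} {s u : LExp S}
    (h : Le (shiftBy es.length s) u.shell) : Le s (lets es u).shell := by
  induction es generalizing s with
  | nil => rwa [List.length_nil, shiftBy_zero] at h
  | cons e es ih =>
    rw [List.length_cons, ← shiftBy_shift] at h
    simpa only [shift_inst, lets, shell] using (ih h).inst (.refl e.shell)

end LExp

theorem Steps.lets {P : Program S} {b : Prop} {k : ℕ} (es : List (LExp S)) {u u' : LExp S}
    (h : Steps P b (k + es.length) u u') : Steps P b k (lets es u) (lets es u') := by
  induction es generalizing k with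
  | nil => exact h
  | cons e es ih =>
    refine .letR e (ih ?_)
    rwa [List.length_cons, Nat.add_comm es.length, ← Nat.add_assoc] at h

theorem Steps.flat {P : Program S} {b : Prop} {k : ℕ} (es : List (LExp S)) (u c : LExp S) :
    Steps P b k (letIn (LExp.lets es u) c)
      (LExp.lets es (letIn u (ren (liftRen (· + es.length)) c))) := by
  induction es generalizing k c with
  | nil =>
    have : liftRen (· + 0) = id := by funext n; cases n <;> rfl
    simp only [LExp.lets, List.length_nil, this, ren_id]
    exact .refl
  | cons e es ih =>
    refine .head (.root (.flat _ _ _)) (Steps.letR e ?_)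
    have := ih (k := k + 1) (ren (liftRen Nat.succ) c)
    rw [ren_ren, liftRen_comp] at this
    convert this using 5
    funext n; simp; omega

theorem Steps.elim {P : Program S} {b : Prop} {k : ℕ} (es : List (LExp S)) (u : LExp S) :
    Steps P b k (LExp.lets es (shiftBy es.length u)) u := by
  induction es generalizing k u with
  | nil => rw [List.length_nil, shiftBy_zero]; exact .refl
  | cons e es ih =>
    rw [List.length_cons, ← shiftBy_shift]
    exact .tail (Steps.letR e (ih _)) (.root (.elim _ _))

/-! ### Peeling -/

/-- `u` is a c-term or rooted by a function symbol. -/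
def IsPeeled (b : Prop) (u : LExp S) : Prop := AdmCTerm b u ∨ ∃ f args, u = fn f args

/-- `a` rewrites to a sequence of bindings with a peeled body approximated by the shell of `a`. -/
def Peels (P : Program S) (b : Prop) (k : ℕ) (a : LExp S) : Prop :=
  ∃ es u, Steps P b k a (lets es u) ∧ IsPeeled b u ∧ Le (shiftBy es.length a.shell) u.shell

/-- After flattening, a c-term body is propagated by Bind. A function call instead stays as one more
binding and its variable serves as `t`; its shell being `⊥`, the bound on `s` is then trivial. -/
theorem Steps.absorb {P : Program S} {b : Prop} {k : ℕ} (es : List (LExp S)) {u : LExp S}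
    (hu : IsPeeled b u) (c : LExp S) : ∃ es' t,
      Steps P b k (letIn (LExp.lets es u) c)
        (LExp.lets es' ((ren (liftRen (· + es'.length)) c).inst t)) ∧
      AdmCTerm b t ∧ ∀ s, Le (shiftBy es.length s) u.shell → Le (shiftBy es'.length s) t := by
  rcases hu with hu | ⟨f, args, rfl⟩
  · refine ⟨es, u, (Steps.flat es u c).trans ?_, hu, fun s hs => ?_⟩
    · exact Steps.lets es (.single (.root (.bind _ _ hu)))
    · rwa [hu.1.shell_eq] at hs
  · refine ⟨es ++ [fn f args], .var 0, ?_, AdmCTerm.var b 0, fun s hs => ?_⟩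
    · have := Steps.flat (P := P) (b := b) (k := k) es (fn f args) c
      rw [lets_append, List.length_append, List.length_singleton]
      convert this using 2
      simp only [LExp.lets]
      congr 1
      rw [ren_eq_subst, ren_eq_subst, inst, subst_subst]
      congr 1; funext n
      cases n <;> rfl
    · rw [List.length_append, List.length_singleton, ← shift_shiftBy]
      generalize shiftBy es.length s = s' at hs
      cases hs
      exact .bot _

theorem Peels.letIn {P : Program S} {b : Prop} {k : ℕ} {a : LExp S} (h : Peels P b k a)
    (c : LExp S) : ∃ es t,
      Steps P b k (letIn a c) (lets es ((ren (liftRen (· + es.length)) c).inst t)) ∧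
      AdmCTerm b t ∧ Le (shiftBy es.length a.shell) t := by
  obtain ⟨es, u, hs, hu, hle⟩ := h
  obtain ⟨es', t, hs', ht, hle'⟩ := Steps.absorb es hu c
  exact ⟨es', t, (hs.letL c).trans hs', ht, hle' _ hle⟩

/-- The common properties of the operations `c(…)` and `f(…)`. -/
structure IsNode (P : Program S) (b : Prop) {n : ℕ} (N : (Fin n → LExp S) → LExp S) : Prop where
  ren : ∀ ρ args, ren ρ (N args) = N fun i => ren ρ (args i)
  subst : ∀ σ args, subst σ (N args) = N fun i => subst σ (args i)
  step : ∀ {k args i a}, StepAt P (AdmCTerm b) k (args i) a →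
    StepAt P (AdmCTerm b) k (N args) (N (Function.update args i a))
  suspend : ∀ {k} args i, (args i).Suspendable → StepAt P (AdmCTerm b) k (N args)
    (letIn (args i) (N (Function.update (fun j => (args j).shift) i (var 0))))

theorem isNode_con (P : Program S) (b : Prop) (c : S.CS) : IsNode P b (con c) :=
  ⟨fun _ _ => rfl, fun _ _ => rfl, .con c _, fun args i h => .root (.letInCon c i args h)⟩

theorem isNode_fn (P : Program S) (b : Prop) (f : S.FS) : IsNode P b (fn f) :=
  ⟨fun _ _ => rfl, fun _ _ => rfl, .fn f _, fun args i h => .root (.letInFn f i args h)⟩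

theorem IsNode.steps_update {P : Program S} {b : Prop} {n : ℕ} {N : (Fin n → LExp S) → LExp S}
    (hN : IsNode P b N) {k : ℕ} {args : Fin n → LExp S} {i : Fin n} {a : LExp S}
    (h : Steps P b k (args i) a) : Steps P b k (N args) (N (Function.update args i a)) := by
  induction h with
  | refl => rw [Function.update_eq_self]
  | @tail a a' _ h ih =>
    refine ih.tail ?_
    have := hN.step (args := Function.update args i a) (i := i) (a := a') (by simpa using h)
    rwa [Function.update_idem] at this

theorem IsNode.steps {P : Program S} {b : Prop} {n : ℕ} {N : (Fin n → LExp S) → LExp S}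
    (hN : IsNode P b N) {k : ℕ} {args args' : Fin n → LExp S}
    (h : ∀ i, Steps P b k (args i) (args' i)) : Steps P b k (N args) (N args') :=
  pi_induction (R := fun a a' => Steps P b k (N a) (N a')) (fun _ => .refl)
    (fun _ _ _ => .trans) (fun _ _ _ h => hN.steps_update h) h

theorem IsNode.peel_arg {P : Program S} {b : Prop} {n : ℕ} {N : (Fin n → LExp S) → LExp S}
    (hN : IsNode P b N) {k : ℕ} {args : Fin n → LExp S} {i : Fin n}
    (h : Peels P b k (args i)) : ∃ es t,
      Steps P b k (N args)
        (lets es (N (Function.update (fun j => shiftBy es.length (args j)) i t))) ∧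
      AdmCTerm b t ∧ Le (shiftBy es.length (args i).shell) t := by
  obtain ⟨es, u, hs, hu, hle⟩ := h
  have hs' := hN.steps_update hs
  by_cases hsusp : (lets es u).Suspendable
  · obtain ⟨es', t, hs'', ht, hle'⟩ := Steps.absorb (P := P) (k := k) es hu
      (N (Function.update (fun j => (args j).shift) i (var 0)))
    refine ⟨es', t, hs'.trans (.head (b := letIn (lets es u)
      (N (Function.update (fun j => (args j).shift) i (var 0)))) ?_ ?_), ht, hle' _ hle⟩
    · have := hN.suspend (k := k) (Function.update args i (lets es u)) i (by simpa using hsusp)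
      rw [Function.update_self] at this
      convert this using 3
      funext j
      by_cases hj : j = i
      · subst hj; simp
      · simp [hj]
    · convert hs'' using 2
      rw [hN.ren, inst, hN.subst]
      congr 1
      funext j
      by_cases hj : j = i
      · subst hj; simp [LExp.ren, liftRen, LExp.subst, single]
      · simp only [ne_eq, hj, not_false_eq_true, Function.update_of_ne, shift, ren_ren, subst_ren]
        exact ren_eq_subst _ _
  -- A peeled expression that cannot be suspended has no bindings and is already a c-term.
  · cases es with
    | cons e es => exact (hsusp trivial).elim
    | nil =>
      have hu : AdmCTerm b u := hu.resolve_right fun ⟨f, a, hf⟩ => hsusp (by subst hf; trivial)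
      refine ⟨[], u, ?_, hu, by rwa [hu.1.shell_eq] at hle⟩
      simpa only [List.length_nil, shiftBy_zero, lets] using hs'

/-- Peeling one argument moves the others below new binders; hence the hypothesis for all shifts and
depths. -/
theorem IsNode.peel_args {P : Program S} {b : Prop} {n : ℕ} {N : (Fin n → LExp S) → LExp S}
    (hN : IsNode P b N) {k : ℕ} {args : Fin n → LExp S}
    (h : ∀ i m k, Peels P b k (shiftBy m (args i))) : ∃ es ts,
      Steps P b k (N args) (lets es (N ts)) ∧
      ∀ i, AdmCTerm b (ts i) ∧ Le (shiftBy es.length (args i).shell) (ts i) := by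
  have key : ∀ s : Finset (Fin n), ∃ es ts, Steps P b k (N args) (lets es (N ts)) ∧
      (∀ i ∈ s, AdmCTerm b (ts i) ∧ Le (shiftBy es.length (args i).shell) (ts i)) ∧
      ∀ i ∉ s, ts i = shiftBy es.length (args i) := by
    intro s
    induction s using Finset.induction_on with
    | empty => exact ⟨[], args, .refl, by simp, fun i _ => (shiftBy_zero _).symm⟩
    | insert i s hi ih =>
      obtain ⟨es, ts, hs, hmem, hnot⟩ := ih
      have hp : Peels P b (k + es.length) (ts i) := by rw [hnot i hi]; exact h _ _ _
      obtain ⟨es', t, hs', ht, hle⟩ := hN.peel_arg hp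
      refine ⟨es ++ es', Function.update (fun j => shiftBy es'.length (ts j)) i t, hs.trans ?_,
        fun j hj => ?_, fun j hj => ?_⟩
      · rw [lets_append]; exact Steps.lets es hs'
      · rw [List.length_append, ← shiftBy_shiftBy]
        by_cases hji : j = i
        · subst hji
          rw [Function.update_self]
          refine ⟨ht, ?_⟩
          rwa [hnot j hi, shiftBy, shiftBy, shell_ren] at hle
        · rw [Function.update_of_ne hji]
          obtain ⟨h₁, h₂⟩ := hmem j ((Finset.mem_insert.1 hj).resolve_left hji)
          exact ⟨h₁.ren _, h₂.ren _⟩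
      · rw [Finset.mem_insert, not_or] at hj
        rw [Function.update_of_ne hj.1, hnot j hj.2, List.length_append, shiftBy_shiftBy]
  obtain ⟨es, ts, hs, hmem, -⟩ := key Finset.univ
  exact ⟨es, ts, hs, fun i => hmem i (Finset.mem_univ i)⟩

/-- Peeling a definiens replaces the let variable by a c-term in the body. Quantifying over
substitutions keeps that instance within reach of the structural induction. -/
theorem peels_subst {P : Program S} {b : Prop} {a : LExp S} (ha : Adm b a) (k : ℕ)
    {σ : ℕ → LExp S} (hσ : ∀ x, AdmCTerm b (σ x)) : Peels P b k (subst σ a) := by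
  induction a generalizing k σ with
  | var n => exact ⟨[], _, .refl, .inl (hσ n), by rw [List.length_nil, shiftBy_zero]; exact .refl _⟩
  | bot => exact ⟨[], _, .refl, .inl ⟨trivial, ha⟩, .bot _⟩
  | con c args ih =>
    obtain ⟨es, ts, hs, hts⟩ := (isNode_con P b c).peel_args (k := k)
      (args := fun i => subst σ (args i)) fun i m k => by
        rw [shiftBy, ren_subst]
        exact ih i (ha.imp_right fun h => h i) k fun x => (hσ x).ren _
    have hc : AdmCTerm b (con c ts) := by
      refine ⟨fun i => (hts i).1.1, ?_⟩
      by_cases hb : b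
      · exact .inl hb
      · exact .inr fun i => (hts i).1.2.resolve_left hb
    refine ⟨es, con c ts, hs, .inl hc, ?_⟩
    rw [hc.1.shell_eq]
    exact .con c fun i => (hts i).2
  | fn f args ih => exact ⟨[], _, .refl, .inr ⟨_, _, rfl⟩, .bot _⟩
  | letIn a₁ a₂ ih₁ ih₂ =>
    obtain ⟨es, t, hs, ht, hle⟩ :=
      (ih₁ (ha.imp_right fun h => h.1) k hσ).letIn (subst (up σ) a₂)
    have heq : (ren (liftRen (· + es.length)) (subst (up σ) a₂)).inst t =
        subst (scons t fun x => shiftBy es.length (σ x)) a₂ := by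
      rw [ren_subst, ren_comp_up, subst_up_inst]; rfl
    have hσ' : ∀ x, AdmCTerm b (scons t (fun x => shiftBy es.length (σ x)) x) := by
      intro x
      cases x with
      | zero => exact ht
      | succ x => exact (hσ x).ren _
    obtain ⟨es', u, hs', hu, hle'⟩ :=
      ih₂ (ha.imp_right fun h => h.2) (k + es.length) hσ'
    rw [heq] at hs
    refine ⟨es ++ es', u, ?_, hu, ?_⟩
    · rw [lets_append]; exact hs.trans (Steps.lets es hs')
    · refine Le.trans ?_ hle'
      rw [List.length_append, ← shiftBy_shiftBy, ← heq, inst,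
        shell_subst _ (isPCTerm_single ht.1), shell_ren]
      refine Le.ren ?_ _
      simp only [subst, shell]
      rw [shiftBy, ren_inst]
      exact Le.inst (.refl _) hle

theorem peels {P : Program S} {b : Prop} {a : LExp S} (ha : Adm b a) (k : ℕ) : Peels P b k a := by
  simpa only [subst_var] using peels_subst (P := P) ha k (σ := var) fun x => .var b x

/-! ### Matching of linear patterns -/

namespace LExp

/-- Replacement of `⊥` by the variable `K` in a partial c-term. -/
def fillBot (K : ℕ) : LExp S → LExp S
  | bot => var K
  | con c args => con c fun i => (args i).fillBot K
  | e => e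

theorem le_fillBot (K : ℕ) (e : LExp S) : Le e (e.fillBot K) := by
  induction e with
  | var n => exact .refl _
  | bot => exact .bot _
  | con c args ih => exact .con c ih
  | fn f args ih => exact .refl _
  | letIn e₁ e₂ ih₁ ih₂ => exact .refl _

theorem IsPCTerm.fillBot {t : LExp S} (h : t.IsPCTerm) (K : ℕ) : (t.fillBot K).IsCTerm := by
  induction t with
  | var n => exact ⟨trivial, trivial⟩
  | bot => exact ⟨trivial, trivial⟩
  | con c args ih => exact ⟨fun i => (ih i (h i)).1, fun i => (ih i (h i)).2⟩
  | fn f args ih => exact h.elim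
  | letIn e₁ e₂ ih₁ ih₂ => exact h.elim

/-- The shift moves every variable to `K` or above and `⊥` becomes `K` itself, so no variable is
captured by `K` enclosing binders, as Fapp demands for extra variables. -/
theorem IsPCTerm.le_of_mem_FV_fillBot {t : LExp S} (h : t.IsPCTerm) {K y : ℕ}
    (hy : y ∈ ((shiftBy K t).fillBot K).FV) : K ≤ y := by
  induction t with
  | var n =>
    simp only [FV, Set.mem_ofPred_eq, shiftBy, LExp.ren, LExp.fillBot, occ] at hy
    split_ifs at hy with h' <;> omega
  | bot =>
    simp only [FV, Set.mem_ofPred_eq, shiftBy, LExp.ren, LExp.fillBot, occ] at hy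
    split_ifs at hy with h' <;> omega
  | con c args ih =>
    simp only [FV, Set.mem_ofPred_eq, shiftBy, LExp.ren, LExp.fillBot, occ] at hy ih
    obtain ⟨i, -, hi⟩ := Finset.exists_ne_zero_of_sum_ne_zero hy.ne'
    exact ih i (h i) (Nat.pos_of_ne_zero hi)
  | fn f args ih => exact h.elim
  | letIn e₁ e₂ ih₁ ih₂ => exact h.elim

end LExp

/-- Substitutions for the members of a linear tuple of patterns can be merged. -/
theorem exists_subst_of_linear {n : ℕ} {p t : Fin n → LExp S} (hlin : ∀ x, ∑ i, (p i).occ x ≤ 1)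
    {G : ℕ → LExp S → Prop} {d : ℕ → LExp S} (hd : ∀ x, G x (d x))
    (h : ∀ i, ∃ θ : ℕ → LExp S, t i = subst θ (p i) ∧ ∀ x, G x (θ x)) :
    ∃ θ : ℕ → LExp S, (∀ i, t i = subst θ (p i)) ∧ (∀ x, G x (θ x)) ∧
      ∀ x, (∀ i, x ∉ (p i).FV) → θ x = d x := by
  classical
  choose θ hθ hG using h
  refine ⟨fun x => if hx : ∃ i, x ∈ (p i).FV then θ hx.choose x else d x, fun i => ?_,
    fun x => ?_, fun x hx => ?_⟩
  · rw [hθ i]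
    refine subst_congr fun x hx => ?_
    have hx' : ∃ i, x ∈ (p i).FV := ⟨i, hx⟩
    -- Two different members containing `x` would give it two occurrences.
    have hi : hx'.choose = i := by
      by_contra hne
      have h₁ : 0 < (p hx'.choose).occ x := hx'.choose_spec
      have h₂ : 0 < (p i).occ x := hx
      have h₃ : ∑ j ∈ {hx'.choose, i}, (p j).occ x ≤ ∑ j, (p j).occ x :=
        Finset.sum_le_sum_of_subset (Finset.subset_univ _)
      rw [Finset.sum_pair hne] at h₃
      have := hlin x
      omega
    rw [dif_pos hx', hi]
  · dsimp only
    split_ifs with hx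
    · exact hG _ _
    · exact hd x
  · exact dif_neg (by simpa using hx)

/-- As `p` contains no `⊥`, anything above its instance repeats its constructors; the subterms at
its variables define `θ'`. -/
theorem exists_match {p : LExp S} (hp : p.IsCTerm) (hlin : ∀ x, p.occ x ≤ 1) {b : Prop}
    {θ d : ℕ → LExp S} (hd : ∀ x, Le (θ x) (d x) ∧ AdmCTerm b (d x)) {t : LExp S}
    (ht : AdmCTerm b t) (hle : Le (subst θ p) t) :
    ∃ θ' : ℕ → LExp S, t = subst θ' p ∧ ∀ x, Le (θ x) (θ' x) ∧ AdmCTerm b (θ' x) := by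
  induction p generalizing t with
  | var n =>
    refine ⟨Function.update d n t, by simp [subst], fun x => ?_⟩
    by_cases hx : x = n
    · subst hx; simpa using ⟨hle, ht⟩
    · simpa [hx] using hd x
  | bot => exact hp.2.elim
  | con c args ih =>
    cases hle with | @con _ _ ts hle =>
    obtain ⟨θ', h₁, h₂, -⟩ := exists_subst_of_linear (p := args) (t := ts) hlin
      (G := fun x u => Le (θ x) u ∧ AdmCTerm b u) hd fun i =>
        ih i ⟨hp.1 i, hp.2 i⟩
          (fun x => (Finset.single_le_sum (f := fun i => (args i).occ x)
            (fun _ _ => Nat.zero_le _) (Finset.mem_univ i)).trans (hlin x))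
          ⟨ht.1 i, ht.2.imp_right fun h => h i⟩ (hle i)
    exact ⟨θ', by rw [subst, funext h₁], h₂⟩
  | fn f args ih => exact hp.1.elim
  | letIn e₁ e₂ ih₁ ih₂ => exact hp.1.elim

theorem Rule.exists_match (R : Rule S) {b : Prop} {θ d : ℕ → LExp S}
    (hd : ∀ x, Le (θ x) (d x) ∧ AdmCTerm b (d x)) {ts : Fin (S.farity R.f) → LExp S}
    (hts : ∀ i, AdmCTerm b (ts i) ∧ Le (subst θ (R.pat i)) (ts i)) :
    ∃ θ' : ℕ → LExp S, (∀ i, ts i = subst θ' (R.pat i)) ∧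
      (∀ x, Le (θ x) (θ' x) ∧ AdmCTerm b (θ' x)) ∧
      ∀ x, (∀ i, x ∉ (R.pat i).FV) → θ' x = d x :=
  exists_subst_of_linear (G := fun x u => Le (θ x) u ∧ AdmCTerm b u) R.linear hd fun i =>
    LetRw.exists_match (R.pat_cterm i)
      (fun x => (Finset.single_le_sum (f := fun i => (R.pat i).occ x)
        (fun _ _ => Nat.zero_le _) (Finset.mem_univ i)).trans (R.linear x))
      hd (hts i).1 (hts i).2

/-! ### Completeness of let-rewriting -/

/-- The derivation may use partial values where rewriting must use total ones, so the rewritten `e`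
need only lie above the shifted `e₀`. -/
theorem CRWLlet.exists_steps {P : Program S} {b : Prop} {e₀ t : LExp S} (h : CRWLlet P e₀ t)
    (k : ℕ) {e : LExp S} (he : Adm b e) (hle : Le (shiftBy k e₀) e) :
    ∃ e', Steps P b k e e' ∧ Le (shiftBy k t) e'.shell := by
  induction h generalizing k e with
  | B e₀ => exact ⟨e, .refl, .bot _⟩
  | RR x => cases hle; exact ⟨_, .refl, .refl _⟩
  | DC c e₀ t h ih =>
    cases hle with | @con _ _ es hle =>
    choose e' hs hle' using fun i => ih i k (he.imp_right fun h => h i) (hle i)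
    exact ⟨con c e', (isNode_con P b c).steps hs, .con c hle'⟩
  | OR R θ e₀ t hR h₁ h₂ ih₁ ih₂ =>
    cases hle with | @fn _ _ es hle =>
    choose e' hs hle' using fun i => ih₁ i k (he.imp_right fun h => h i) (hle i)
    have he' : ∀ i, Adm b (e' i) := fun i => (hs i).adm (he.imp_right fun h => h i)
    obtain ⟨fs, ts, hs', hts⟩ := (isNode_fn P b R.f).peel_args (k := k) (args := e')
      fun i m k => peels ((he' i).ren _) k
    obtain ⟨θ', hpat, hθ', hextra⟩ := R.exists_match (b := b)
      (θ := fun x => shiftBy (k + fs.length) (θ.1 x))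
      -- Extra variables are not determined by matching: they take the value from the derivation,
      -- shifted past all binders, with `⊥` made a free variable to stay total.
      (d := fun x => (shiftBy (k + fs.length) (θ.1 x)).fillBot (k + fs.length))
      (fun x => ⟨le_fillBot _ _, (((θ.2 x).ren _).fillBot _).1, .inr (((θ.2 x).ren _).fillBot _).2⟩)
      (ts := ts) fun i => ⟨(hts i).1, by
        have := ((hle' i).ren (· + fs.length)).trans (hts i).2
        rw [← shiftBy, shiftBy_shiftBy, shiftBy, ren_subst] at this
        exact this⟩
    have hstep : StepAt P (AdmCTerm b) (k + fs.length) (fn R.f ts) (subst θ' R.rhs) := by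
      rw [funext hpat]
      refine .root (.fapp R θ' hR (fun x => (hθ' x).2) fun x hx y hy => ?_)
      rw [hextra x hx] at hy
      exact (θ.2 x).le_of_mem_FV_fillBot hy
    have hred := ((isNode_fn P b R.f).steps hs).trans (hs'.trans (Steps.lets fs (.single hstep)))
    have hrhs : Adm b (subst θ' R.rhs) := by
      by_cases hb : b
      · exact .inl hb
      · exact .inr (R.rhs_total.subst fun x => (hθ' x).2.2.resolve_left hb)
    obtain ⟨e'', hs'', hle''⟩ := ih₂ (k + fs.length) hrhs (by
      rw [shiftBy, ren_subst]; exact Le.subst (.refl _) fun x => (hθ' x).1)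
    exact ⟨lets fs e'', hred.trans (Steps.lets fs hs''),
      le_shell_lets (by rwa [shiftBy_shiftBy])⟩
  | Let a₀ c₀ t₁ t ht₁ h₁ h₂ ih₁ ih₂ =>
    cases hle with | @letIn _ a _ c hle₁ hle₂ =>
    obtain ⟨a', hs, hle'⟩ := ih₁ k (he.imp_right fun h => h.1) hle₁
    obtain ⟨fs, t', hs', ht', hlet'⟩ :=
      (peels (P := P) (Steps.adm hs (he.imp_right fun h => h.1)) k).letIn c
    have hred := (hs.letL c).trans hs'
    have hadm : Adm b ((ren (liftRen (· + fs.length)) c).inst t') := by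
      by_cases hb : b
      · exact .inl hb
      · refine .inr (((he.resolve_left hb).2.ren _).subst fun x => ?_)
        cases x with
        | zero => exact ht'.2.resolve_left hb
        | succ x => trivial
    obtain ⟨e'', hs'', hle''⟩ := ih₂ (k + fs.length) hadm (by
      rw [← shiftBy_shiftBy, shiftBy, shiftBy, ren_inst, ren_inst]
      exact (hle₂.ren _).inst ((hle'.ren _).trans hlet'))
    exact ⟨lets fs e'', hred.trans (Steps.lets fs hs''),
      le_shell_lets (by rwa [shiftBy_shiftBy])⟩

/-! ### Reaching c-terms and assembling the theorem -/

/-- An expression whose shell is a (total) c-term rewrites to its shell. -/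
theorem steps_shell {P : Program S} {b : Prop} {k : ℕ} {e : LExp S} (he : Adm b e)
    (ht : e.shell.IsCTerm) : Steps P b k e e.shell := by
  obtain ⟨es, u, hs, hu, hle⟩ := peels (P := P) he k
  have hshift : (shiftBy es.length e.shell).IsCTerm := ⟨ht.1.ren _, ht.2.ren _⟩
  have heq := hle.eq_of_isCTerm hshift
  rcases hu with hu | ⟨f, args, rfl⟩
  · rw [hu.1.shell_eq] at heq
    rw [← heq] at hs
    exact hs.trans (Steps.elim es _)
  -- A function call has shell `⊥`, which is not total.
  · rw [heq] at hshift
    exact hshift.2.elim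

theorem Steps.reflTransGen {P : Program S} {b : Prop} {e e' : LExp S} (h : Steps P b 0 e e') :
    Relation.ReflTransGen (Step P (AdmCTerm b)) e e' :=
  h.lift id fun _ _ => StepAt.step

theorem den_eq {P : Program S} {b : Prop} {e : LExp S} (he : Adm b e) :
    den P e = downClosure
      {s | ∃ e', Relation.ReflTransGen (Step P (AdmCTerm b)) e e' ∧ s = e'.shell} := by
  ext t
  constructor
  · rintro ⟨-, h⟩
    obtain ⟨e', hs, hle⟩ := h.exists_steps 0 he (by rw [shiftBy_zero]; exact .refl e)
    rw [shiftBy_zero] at hle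
    exact ⟨e'.shell, ⟨e', hs.reflTransGen, rfl⟩, hle.approx⟩
  · rintro ⟨_, ⟨e', hs, rfl⟩, hle⟩
    have := (CRWLlet.of_steps (fun t ht => ht.1) hs (.shell e')).mono (.refl _) (.of_approx hle)
    exact ⟨this.isPCTerm, this⟩

theorem crwlLet_iff_letRewrites {P : Program S} {e t : LExp S} (he : e.Total) (ht : t.IsCTerm) :
    CRWLlet P e t ↔ LetRewrites P e t := by
  constructor
  · intro h
    have he' : Adm False e := .inr he
    obtain ⟨e', hs, hle⟩ := h.exists_steps 0 he' (by rw [shiftBy_zero]; exact .refl e)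
    rw [shiftBy_zero] at hle
    have heq := hle.eq_of_isCTerm ht
    have := hs.trans (steps_shell (hs.adm he') (heq ▸ ht))
    rw [← heq] at this
    simpa only [LetRewrites, admCTerm_false] using Steps.reflTransGen this
  · exact fun h => CRWLlet.of_steps (fun t ht => ht.1) h (.self ht.1)

end LetRw

theorem mainTheorem1 {S : LetRw.Signature} (P : LetRw.Program S) (e : LetRw.LExp S)
    (he : e.Total) :
    LetRw.den P e = LetRw.downClosure {s | ∃ e', LetRw.LetRewrites P e e' ∧ s = e'.shell} ∧
    LetRw.hyperDen P e =
      (fun θ => LetRw.downClosure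
        {s | ∃ e', LetRw.PLetRewrites P (e.subst θ.1) e' ∧ s = e'.shell}) ∧
    (∀ t : LetRw.LExp S, t.IsCTerm → (LetRw.CRWLlet P e t ↔ LetRw.LetRewrites P e t)) ∧
    (P.NoLets → e.LetFree →
      ∀ t : LetRw.LExp S, t.IsCTerm → (LetRw.CRWL P e t ↔ LetRw.LetRewrites P e t)) := by
  refine ⟨?_, ?_, fun t ht => LetRw.crwlLet_iff_letRewrites he ht, fun hP hlet t ht => ?_⟩
  · have := LetRw.den_eq (P := P) (b := False) (.inr he)
    rwa [LetRw.admCTerm_false] at this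
  · funext θ
    have := LetRw.den_eq (P := P) (b := True) (e := e.subst θ.1) (.inl trivial)
    rwa [LetRw.admCTerm_true] at this
  · rw [← LetRw.crwlLet_iff_letRewrites he ht]
    exact ⟨LetRw.CRWL.toLet, fun h => h.toCRWL hP hlet⟩
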